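/- An overpartition is a finite partition (a multiset of positive integers, possibly empty) in which the first occurrence of each part may be overlined; it has distinct parts if its non-overlined parts are pairwise distinct (the overlined parts always are, and a number may occur once overlined and once non-overlined). An overpartition pair of $n$ is a pair $\pi=(\lambda_1,\lambda_2)$ of overpartitions whose parts sum to $n$ altogether; its number of parts is the total number of parts, overlined or not, of $\lambda_1$ and $\lambda_2$. For a positive integer $n$, let $C(n)$ count the overpartition pairs $\pi=(\lambda_1,\lambda_2)$ of $n$ such that both $\lambda_1$ and $\lambda_2$ have distinct parts and, with $s$ denoting the smallest part of $\pi$: $s$ is also the smallest part of $\lambda_1$ and occurs overlined in $\lambda_1$, all overlined parts of $\lambda_2$ are $>s$, and all non-overlined parts of $\lambda_2$ are $<2s$. Let $C_0(n)$ (resp. $C_1(n)$) be the number of those pairs with an even (resp. odd) number of parts, and let $C'(n)=C_1(n)-C_0(n)$. A triangular number is a number $k(k+1)/2$ with $k\ge 0$ an integer. Then: 1. A non-negative integer $n$ is a sum of two triangular numbers if and only if $8n+2$ is a sum of two squares of integers. 2. For every positive integer $n$ that is not a sum of two triangular numbers, $C'(n)=0$, i.e. $C_0(n)=C_1(n)$.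 Also, for every such $n$, the coefficient of $q^n$ in the formal power series $$\sum_{m\ge 1} q^m (q^{m+1};q)_\infty^2\,(q^m;q)_\infty\,(q^m;q)_m$$ is $0$, where $(a;q)_m=\prod_{j=0}^{m-1}(1-aq^j)$ and $(a;q)_\infty=\prod_{j\ge 0}(1-aq^j)$. -/

import Mathlib

/-- An overpartition: a partition in which the first occurrence of each part may be overlined.
It is recorded by its overlined parts (no size can be overlined twice, so they form a finite set)
together with the multiset of its non-overlined parts. -/
@[ext]
structure Overpartition where
  overlined : Finset ℕ
  nonOverlined : Multiset ℕ
  overlined_pos : ∀ k ∈ overlined, 0 < k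
  nonOverlined_pos : ∀ k ∈ nonOverlined, 0 < k

namespace Overpartition

/-- All parts, overlined or not, with multiplicity. -/
def parts (l : Overpartition) : Multiset ℕ := l.overlined.val + l.nonOverlined

/-- An overpartition has distinct parts if its non-overlined parts are distinct too
(a size may still occur once overlined and once non-overlined). -/
def HasDistinctParts (l : Overpartition) : Prop := l.nonOverlined.Nodup

end Overpartition

/-- An overpartition pair; either component may be empty. -/
abbrev OverpartitionPair : Type := Overpartition × Overpartition

namespace OverpartitionPair

/-- All parts of both components, with multiplicity. -/
def parts (p : OverpartitionPair) : Multiset ℕ := p.1.parts + p.2.parts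

/-- `p` is an overpartition pair of `n`. -/
def IsPairOf (p : OverpartitionPair) (n : ℕ) : Prop := p.parts.sum = n

/-- The number of parts of a pair. -/
def numParts (p : OverpartitionPair) : ℕ := p.parts.card

/-- The overpartition pairs `p = (l₁, l₂)` of `n` into distinct parts such that, with `s` the
smallest part of `p`: `s` is also the smallest part of `l₁` and occurs overlined in `l₁`, the
overlined parts of `l₂` are `> s`, and the non-overlined parts of `l₂` are `< 2 s`. -/
def CountedByC (n : ℕ) (p : OverpartitionPair) : Prop :=
  p.IsPairOf n ∧ p.1.HasDistinctParts ∧ p.2.HasDistinctParts ∧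
    ∃ s : ℕ, IsLeast {k | k ∈ p.parts} s ∧ IsLeast {k | k ∈ p.1.parts} s ∧
      s ∈ p.1.overlined ∧
      (∀ k ∈ p.2.overlined, s < k) ∧
      (∀ k ∈ p.2.nonOverlined, k < 2 * s)

/-- Only finitely many pairs are counted, so the cardinalities below are genuine. -/
theorem finite_countedByC (n : ℕ) : {p : OverpartitionPair | CountedByC n p}.Finite := by
  let f : OverpartitionPair → (Finset ℕ × Multiset ℕ) × (Finset ℕ × Multiset ℕ) :=
    fun p => ((p.1.overlined, p.1.nonOverlined), (p.2.overlined, p.2.nonOverlined))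
  have hf : Function.Injective f := by
    rintro ⟨a, b⟩ ⟨c, d⟩ h
    simp only [f, Prod.mk.injEq] at h
    exact Prod.ext (Overpartition.ext h.1.1 h.1.2) (Overpartition.ext h.2.1 h.2.2)
  let S : Set (Finset ℕ × Multiset ℕ) :=
    Set.Iic (Finset.range (n + 1)) ×ˢ Set.Iic (Finset.range (n + 1)).val
  have hS : S.Finite := (Set.finite_Iic _).prod (Set.finite_Iic _)
  refine ((hS.prod hS).preimage hf.injOn).subset ?_
  rintro p ⟨hn, h1, h2, -⟩
  have hle : ∀ k ∈ p.parts, k < n + 1 := fun k hk => by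
    have h := Multiset.le_sum_of_mem hk
    unfold IsPairOf at hn
    omega
  have e : p.parts = (p.1.overlined.val + p.1.nonOverlined)
    + (p.2.overlined.val + p.2.nonOverlined) := rfl
  simp only [e, Multiset.mem_add, Finset.mem_val] at hle
  refine ⟨⟨fun k hk => ?_, (Multiset.le_iff_subset h1).2 fun k hk => ?_⟩,
    ⟨fun k hk => ?_, (Multiset.le_iff_subset h2).2 fun k hk => ?_⟩⟩ <;>
  · first | rw [Finset.mem_range] | rw [Finset.mem_val, Finset.mem_range]
    exact hle k (by tauto)

/-- `C₀(n)`: the number of pairs counted by `C(n)` with an even number of parts. -/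
noncomputable def C₀ (n : ℕ) : ℕ :=
  {p : OverpartitionPair | CountedByC n p ∧ Even p.numParts}.ncard

/-- `C₁(n)`: the number of pairs counted by `C(n)` with an odd number of parts. -/
noncomputable def C₁ (n : ℕ) : ℕ :=
  {p : OverpartitionPair | CountedByC n p ∧ Odd p.numParts}.ncard

/-- `C'(n) = C₁(n) - C₀(n)`. -/
noncomputable def C' (n : ℕ) : ℤ := (C₁ n : ℤ) - (C₀ n : ℤ)

end OverpartitionPair

namespace QSeries

open PowerSeries

open scoped PowerSeries.WithPiTopology

/-- `(a; q)_n = (1 - a)(1 - a q) ⋯ (1 - a q ^ (n - 1))`, with `q = X`. -/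
noncomputable def poch (a : PowerSeries ℤ) (n : ℕ) : PowerSeries ℤ :=
  ∏ j ∈ Finset.range n, (1 - a * X ^ j)

/-- `(a; q)_∞`, with `q = X`: an infinite product in the usual topology of `ℤ⟦q⟧`. -/
noncomputable def pochInf (a : PowerSeries ℤ) : PowerSeries ℤ :=
  ∏' j : ℕ, (1 - a * X ^ j)

/-- The infinite product defining `(a; q)_∞` converges. -/
theorem multipliable_poch (a : PowerSeries ℤ) :
    Multipliable fun j : ℕ => 1 - a * (X : PowerSeries ℤ) ^ j := by
  simp_rw [sub_eq_add_neg]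
  apply PowerSeries.WithPiTopology.multipliable_one_add_of_tendsto_order_atTop_nhds_top
  refine ENat.tendsto_nhds_top_iff_natCast_lt.mpr fun n =>
    Filter.eventually_atTop.mpr ⟨n + 1, fun m hm => ?_⟩
  rw [order_neg]
  refine lt_of_lt_of_le ?_ (le_order_mul _ _)
  rw [order_X_pow]
  exact lt_of_lt_of_le (by exact_mod_cast hm) le_add_self

/-- The term `q ^ n (q ^ (n + 1); q)_∞ ^ 2 (q ^ n; q)_∞ (q ^ n; q)_n`. -/
noncomputable def termC (n : ℕ) : PowerSeries ℤ :=
  X ^ n * pochInf (X ^ (n + 1)) ^ 2 * pochInf (X ^ n) * poch (X ^ n) n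

/-- The series `∑_{n ≥ 1} q ^ n (q ^ (n + 1); q)_∞ ^ 2 (q ^ n; q)_∞ (q ^ n; q)_n`. -/
noncomputable def seriesC : PowerSeries ℤ := ∑' m : ℕ, termC (m + 1)

/-- The series above converges. -/
theorem summable_termC : Summable fun m : ℕ => termC (m + 1) := by
  apply PowerSeries.WithPiTopology.summable_of_tendsto_order_atTop_nhds_top
  refine ENat.tendsto_nhds_top_iff_natCast_lt.mpr fun n =>
    Filter.eventually_atTop.mpr ⟨n, fun m hm => ?_⟩
  unfold termC
  rw [mul_assoc, mul_assoc]
  refine lt_of_lt_of_le ?_ (le_order_mul _ _)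
  rw [order_X_pow]
  exact lt_of_lt_of_le (by exact_mod_cast Nat.lt_succ_of_le hm) le_self_add

end QSeries

/-- `n` is a sum of two triangular numbers `k (k + 1) / 2`, `k ≥ 0` (zero is triangular). -/
def IsSumOfTwoTriangular (n : ℕ) : Prop :=
  ∃ a b : ℕ, n = a * (a + 1) / 2 + b * (b + 1) / 2

/-- `n` is a sum of two squares of integers. -/
def IsSumOfTwoSquares (n : ℕ) : Prop :=
  ∃ x y : ℤ, (n : ℤ) = x ^ 2 + y ^ 2

/-! ### Gaussian binomials, the finite `q`-binomial theorem and `q`-Vandermonde -/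

namespace QSeries

open PowerSeries Finset

/-! `seriesC` generates `C'`: the overlined `s` gives `q^s`, the other overlined parts and the
non-overlined parts of the first component give `(q^{s+1};q)_∞` and `(q^s;q)_∞`, those of the second
give `(q^{s+1};q)_∞` and `(q^s;q)_s`, and each part carries a sign.

The series factors as `(∑ (-1)^i q^{i(i-1)/2}) (∑ (-1)^j q^{j(j+1)/2})` (`seriesC_eq`). All
exponents are triangular, so a nonzero coefficient forces a sum of two triangular numbers.

For the factorization, expand `(q^n;q)_n` by the `q`-binomial theorem with `n = r + p`, and
`(q^n;q)_∞` and one `(q^{n+1};q)_∞` by Euler with indices `k`, `l`. The sum over `p` is again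
Euler's and gives `(q;q)_{r+k+l}`. With `i = r + k` and `j = r + l`, `q`-Vandermonde collapses the
remaining inner sum to `1`. -/

theorem choose_two_succ (n : ℕ) : (n + 1).choose 2 = n.choose 2 + n := by
  rw [Nat.choose_succ_succ' n 1, Nat.choose_one_right, add_comm]

theorem choose_two_add (m n : ℕ) : (m + n).choose 2 = m.choose 2 + n.choose 2 + m * n := by
  induction n with
  | zero => simp
  | succ n ih => rw [← add_assoc, choose_two_succ, ih, choose_two_succ]; ring

theorem sq_eq_choose_two (n : ℕ) : n * n = 2 * n.choose 2 + n := by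
  induction n with
  | zero => simp
  | succ n ih => rw [choose_two_succ]; linarith

theorem poch_zero (a : ℤ⟦X⟧) : poch a 0 = 1 := by simp [poch]

theorem poch_succ (a : ℤ⟦X⟧) (n : ℕ) : poch a (n + 1) = poch a n * (1 - a * X ^ n) :=
  prod_range_succ _ _

theorem poch_X_succ (n : ℕ) : poch X (n + 1) = poch X n * (1 - X ^ (n + 1)) := by
  rw [poch_succ, pow_succ']

/-- The reciprocal of `(q; q)_k`. -/
noncomputable def invPoch (k : ℕ) : ℤ⟦X⟧ := invOfUnit (poch X k) 1

theorem poch_mul_invPoch (k : ℕ) : poch X k * invPoch k = 1 := by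
  apply mul_invOfUnit
  simp [poch, map_prod]

theorem invPoch_zero : invPoch 0 = 1 := by
  simpa [poch_zero] using poch_mul_invPoch 0

theorem one_sub_mul_invPoch_succ (k : ℕ) : (1 - X ^ (k + 1)) * invPoch (k + 1) = invPoch k := by
  have h := poch_mul_invPoch k
  have h' := poch_mul_invPoch (k + 1)
  rw [poch_X_succ] at h'
  linear_combination invPoch k * h' - (1 - X ^ (k + 1)) * invPoch (k + 1) * h

/-- The Gaussian binomial coefficient `(q; q)_{r + p} / ((q; q)_r (q; q)_p)`. -/
noncomputable def gauss (r p : ℕ) : ℤ⟦X⟧ := poch X (r + p) * invPoch r * invPoch p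

theorem gauss_zero_left (p : ℕ) : gauss 0 p = 1 := by
  rw [gauss, invPoch_zero, zero_add, mul_one, poch_mul_invPoch]

theorem gauss_zero_right (r : ℕ) : gauss r 0 = 1 := by
  rw [gauss, invPoch_zero, add_zero, mul_one, poch_mul_invPoch]

/-- Split `1 - q^{r+p+2} = (1 - q^{p+1}) + q^{p+1} (1 - q^{r+1})`; each bracket cancels a factor of
one denominator. The primed version exchanges the two roles. -/
theorem gauss_succ_succ (r p : ℕ) :
    gauss (r + 1) (p + 1) = gauss (r + 1) p + X ^ (p + 1) * gauss r (p + 1) := by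
  simp only [gauss]
  rw [show r + 1 + (p + 1) = r + p + 1 + 1 by ring, show r + 1 + p = r + p + 1 by ring,
    show r + (p + 1) = r + p + 1 by ring, poch_X_succ (r + p + 1),
    ← one_sub_mul_invPoch_succ p, ← one_sub_mul_invPoch_succ r]
  ring

theorem gauss_succ_succ' (r p : ℕ) :
    gauss (r + 1) (p + 1) = X ^ (r + 1) * gauss (r + 1) p + gauss r (p + 1) := by
  simp only [gauss]
  rw [show r + 1 + (p + 1) = r + p + 1 + 1 by ring, show r + 1 + p = r + p + 1 by ring,
    show r + (p + 1) = r + p + 1 by ring, poch_X_succ (r + p + 1),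
    ← one_sub_mul_invPoch_succ p, ← one_sub_mul_invPoch_succ r]
  ring

/-- A Pascal-type recurrence on pairs, summed along an antidiagonal. -/
theorem sum_antidiagonal_succ_of_pascal {M : Type*} [AddCommMonoid M] {f g h : ℕ → ℕ → M}
    (h₁ : ∀ p, f 0 (p + 1) = g 0 p) (h₂ : ∀ r, f (r + 1) 0 = h r 0)
    (h₃ : ∀ r p, f (r + 1) (p + 1) = g (r + 1) p + h r (p + 1)) (n : ℕ) :
    ∑ x ∈ antidiagonal (n + 1), f x.1 x.2 =
      ∑ x ∈ antidiagonal n, g x.1 x.2 + ∑ x ∈ antidiagonal n, h x.1 x.2 := by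
  cases n with
  | zero => simp [Nat.sum_antidiagonal_succ, h₁, h₂]
  | succ n =>
    rw [Nat.sum_antidiagonal_succ, Nat.sum_antidiagonal_succ', Nat.sum_antidiagonal_succ,
      Nat.sum_antidiagonal_succ' (f := fun x => h x.1 x.2)]
    simp only [h₁, h₂, h₃, sum_add_distrib]
    abel

/-- The finite `q`-binomial theorem. -/
theorem poch_eq_sum_gauss (c : ℤ⟦X⟧) (n : ℕ) :
    poch c n = ∑ x ∈ antidiagonal n, gauss x.1 x.2 * (-c) ^ x.1 * X ^ x.1.choose 2 := by
  induction n with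
  | zero => simp [poch_zero, gauss_zero_left]
  | succ n ih =>
    -- On the antidiagonal `X ^ (r + p)` is `X ^ n`, so the `g` and `h` sums are the two halves of
    -- the product with `1 - c * X ^ n`.
    rw [sum_antidiagonal_succ_of_pascal
      (f := fun r p => gauss r p * (-c) ^ r * X ^ r.choose 2)
      (g := fun r p => gauss r p * (-c) ^ r * X ^ r.choose 2)
      (h := fun r p => gauss r p * (-c) ^ r * X ^ r.choose 2 * (-c * X ^ (r + p))),
      poch_succ, mul_sub, mul_one, ih, sum_mul, sub_eq_add_neg, ← sum_neg_distrib]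
    · congr 1
      refine sum_congr rfl fun x hx => ?_
      rw [mem_antidiagonal.1 hx]
      ring
    · intro p
      simp [gauss_zero_left]
    · intro r
      rw [gauss_zero_right, gauss_zero_right, choose_two_succ]
      ring
    · intro r p
      rw [gauss_succ_succ, choose_two_succ]
      ring

/-- The coefficient `(-1)^r q^{r(r+1)/2} [i choose r]_q` of `z^r` in `(zq; q)_i`. -/
noncomputable def vanderCoeff : ℕ → ℕ → ℤ⟦X⟧
  | 0, 0 => 1
  | 0, _ + 1 => 0
  | _ + 1, 0 => 1
  | i + 1, r + 1 => vanderCoeff i (r + 1) - X ^ (i + 1) * vanderCoeff i r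

theorem vanderCoeff_zero_right (i : ℕ) : vanderCoeff i 0 = 1 := by
  cases i <;> rfl

theorem vanderCoeff_eq_zero {i r : ℕ} (h : i < r) : vanderCoeff i r = 0 := by
  induction i generalizing r with
  | zero => cases r with
    | zero => omega
    | succ r => rfl
  | succ i ih => cases r with
    | zero => omega
    | succ r => rw [vanderCoeff, ih (by omega), ih (by omega), mul_zero, sub_zero]

/-- Both sides obey the same Pascal recurrence. Writing the upper index as `r + k` avoids truncated
subtraction. -/
theorem vanderCoeff_add (r k : ℕ) :
    vanderCoeff (r + k) r = (-1) ^ r * X ^ (r + 1).choose 2 * gauss r k := by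
  induction hn : r + k generalizing r k with
  | zero =>
    obtain ⟨rfl, rfl⟩ : r = 0 ∧ k = 0 := by omega
    simp [vanderCoeff, gauss_zero_left]
  | succ n ih =>
    cases r with
    | zero => simp [vanderCoeff, gauss_zero_left]
    | succ r =>
      rw [vanderCoeff, ih r k (by omega), choose_two_succ (r + 1)]
      cases k with
      | zero =>
        rw [vanderCoeff_eq_zero (by omega), gauss_zero_right, gauss_zero_right,
          show n = r by omega]
        ring
      | succ k =>
        rw [ih (r + 1) k (by omega), gauss_succ_succ, choose_two_succ (r + 1),
          show n = r + k + 1 by omega]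
        ring

/-- A case of the `q`-Vandermonde summation. -/
theorem sum_vanderCoeff_mul_gauss (i j : ℕ) :
    ∑ x ∈ antidiagonal j, vanderCoeff i x.1 * gauss i x.2 = 1 := by
  -- In generating functions this is `(zq;q)_i / (z;q)_{i+1} = 1 / (1 - z)`.
  induction i with
  | zero =>
    cases j with
    | zero => simp [vanderCoeff, gauss_zero_left]
    | succ j => simp [Nat.sum_antidiagonal_succ, vanderCoeff, gauss_zero_left]
  | succ i ih =>
    rw [← ih]
    cases j with
    | zero => simp [vanderCoeff_zero_right, gauss_zero_right]
    | succ j =>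
      -- The mixed sum of `vanderCoeff i` against `gauss (i + 1)` is peeled at both ends; comparing
      -- the two forms absorbs the extra terms of the two recurrences.
      have h := Nat.sum_antidiagonal_succ (n := j)
        (f := fun x : ℕ × ℕ => vanderCoeff i x.1 * gauss (i + 1) x.2)
      rw [Nat.sum_antidiagonal_succ'] at h
      rw [Nat.sum_antidiagonal_succ,
        Nat.sum_antidiagonal_succ' (f := fun x : ℕ × ℕ => vanderCoeff i x.1 * gauss i x.2)]
      simp only [vanderCoeff, vanderCoeff_zero_right, gauss_zero_right, gauss_succ_succ',
        sub_mul, mul_add, sum_add_distrib, sum_sub_distrib] at h ⊢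
      have e : ∑ x ∈ antidiagonal j, X ^ (i + 1) * vanderCoeff i x.1 * gauss (i + 1) x.2 =
          ∑ x ∈ antidiagonal j, vanderCoeff i x.1 * (X ^ (i + 1) * gauss (i + 1) x.2) :=
        sum_congr rfl fun x _ => by ring
      rw [e]
      linear_combination -h

end QSeries

/-! ### Convergence and Euler's expansions -/

namespace QSeries

open PowerSeries Finset Filter

open scoped PowerSeries.WithPiTopology Topology

/-- A family of power series is summable if only finitely many members have low order. -/
theorem summable_of_X_pow_dvd {ι : Type*} {f : ι → ℤ⟦X⟧} (g : ι → ℕ)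
    (hfg : ∀ i, X ^ g i ∣ f i) (hg : ∀ N, {i | g i ≤ N}.Finite) : Summable f := by
  rw [WithPiTopology.summable_iff_summable_coeff]
  intro d
  refine summable_of_hasFiniteSupport ((hg d).subset fun i hi => ?_)
  by_contra h
  exact hi (X_pow_dvd_iff.1 (hfg i) d (not_le.1 h))

theorem X_pow_dvd_of_hasSum {ι : Type*} {f : ι → ℤ⟦X⟧} {s : ℤ⟦X⟧} {m : ℕ} (h : HasSum f s)
    (hf : ∀ i, X ^ m ∣ f i) : X ^ m ∣ s := by
  rw [X_pow_dvd_iff]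
  intro d hd
  have h' := (WithPiTopology.hasSum_iff_hasSum_coeff ℤ).1 h d
  simp only [X_pow_dvd_iff.1 (hf _) d hd] at h'
  exact h'.unique hasSum_zero

theorem tendsto_of_X_pow_dvd_sub {f : ℕ → ℤ⟦X⟧} {s : ℤ⟦X⟧} (h : ∀ n, X ^ n ∣ f n - s) :
    Tendsto f atTop (𝓝 s) := by
  rw [WithPiTopology.tendsto_iff_coeff_tendsto]
  intro d
  refine tendsto_const_nhds.congr' ?_
  filter_upwards [eventually_gt_atTop d] with n hn
  have := X_pow_dvd_iff.1 (h n) d hn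
  rw [map_sub, sub_eq_zero] at this
  exact this.symm

theorem tendsto_poch (a : ℤ⟦X⟧) : Tendsto (poch a) atTop (𝓝 (pochInf a)) :=
  (multipliable_poch a).hasProd.tendsto_prod_nat

theorem finite_choose_two_le (N : ℕ) : {k : ℕ | k.choose 2 ≤ N}.Finite := by
  refine (Set.finite_Iic (N + 1)).subset fun k hk => ?_
  cases k with
  | zero => simp
  | succ k =>
    simp only [Set.mem_ofPred_eq, choose_two_succ, Set.mem_Iic] at hk ⊢
    omega

/-- Euler's expansion of `(q^m; q)_∞`. -/
theorem hasSum_pochInf (m : ℕ) :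
    HasSum (fun k => (-1) ^ k * X ^ (m * k + k.choose 2) * invPoch k) (pochInf (X ^ m)) := by
  set f : ℕ → ℕ → ℤ⟦X⟧ := fun m k => (-1) ^ k * X ^ (m * k + k.choose 2) * invPoch k with hf
  have hs (m : ℕ) : Summable (f m) :=
    summable_of_X_pow_dvd (fun k => k.choose 2)
      (fun k => ⟨(-1) ^ k * X ^ (m * k) * invPoch k, by rw [hf]; ring⟩) finite_choose_two_le
  have hf0 (m : ℕ) : f m 0 = 1 := by simp [hf, invPoch_zero]
  have hrec (m : ℕ) : ∑' k, f m k = (1 - X ^ m) * ∑' k, f (m + 1) k := by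
    -- Termwise the difference carries a factor `1 - X ^ k`, which kills `k = 0` and lowers `invPoch
    -- k` to `invPoch (k - 1)`, so the index shifts by one.
    have h : ∑' k, f m k - ∑' k, f (m + 1) k = - X ^ m * ∑' k, f (m + 1) k := by
      rw [← (hs m).tsum_sub (hs (m + 1)), ← (hs (m + 1)).tsum_mul_left,
        ((hs m).sub (hs (m + 1))).tsum_eq_zero_add, hf0, hf0, sub_self, zero_add]
      refine tsum_congr fun k => ?_
      simp only [hf]
      rw [choose_two_succ, ← one_sub_mul_invPoch_succ k]
      ring
    linear_combination h
  have hit (M : ℕ) : ∑' k, f m k = poch (X ^ m) M * ∑' k, f (m + M) k := by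
    induction M with
    | zero => simp [poch_zero]
    | succ M ih => rw [ih, hrec (m + M), poch_succ, pow_add, add_assoc]; ring
  have hlim : Tendsto (fun M => ∑' k, f (m + M) k) atTop (𝓝 1) := by
    refine tendsto_of_X_pow_dvd_sub fun M => ?_
    rw [(hs _).tsum_eq_zero_add, hf0, add_sub_cancel_left]
    refine X_pow_dvd_of_hasSum ((summable_nat_add_iff 1).2 (hs (m + M))).hasSum fun k =>
      ⟨(-1) ^ (k + 1) * X ^ (m + (m + M) * k + (k + 1).choose 2) * invPoch (k + 1), ?_⟩
    simp only [hf]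
    ring
  have h := ((tendsto_poch (X ^ m)).mul hlim).congr fun M => (hit M).symm
  rw [mul_one] at h
  rw [tendsto_nhds_unique h tendsto_const_nhds]
  exact (hs m).hasSum

theorem X_pow_dvd_pochInf_sub_one (m : ℕ) : X ^ m ∣ pochInf (X ^ m) - 1 := by
  have h := (hasSum_nat_add_iff' 1).2 (hasSum_pochInf m)
  simp only [sum_range_one, pow_zero, mul_zero, Nat.choose_zero_succ, add_zero, invPoch_zero,
    mul_one] at h
  exact X_pow_dvd_of_hasSum h fun k =>
    ⟨(-1) ^ (k + 1) * X ^ (m * k + (k + 1).choose 2) * invPoch (k + 1), by ring⟩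

theorem pochInf_eq_poch_mul (m M : ℕ) :
    pochInf (X ^ m) = poch (X ^ m) M * pochInf (X ^ (m + M)) := by
  have h : Tendsto (fun N => poch (X ^ m) M * poch (X ^ (m + M)) N) atTop
      (𝓝 (poch (X ^ m) M * pochInf (X ^ (m + M)))) :=
    tendsto_const_nhds.mul (tendsto_poch _)
  refine tendsto_nhds_unique ((tendsto_poch _).comp (tendsto_add_atTop_nat M)) (h.congr fun N => ?_)
  simp only [Function.comp, poch]
  rw [add_comm N M, prod_range_add]
  congr 1
  exact prod_congr rfl fun j _ => by ring

/-- Euler's expansion of `1 / (q^{N+1}; q)_∞`, multiplied by `(q; q)_∞`. -/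
theorem hasSum_poch (N : ℕ) :
    HasSum (fun p => pochInf X * (X ^ ((N + 1) * p) * invPoch p)) (poch X N) := by
  set f : ℕ → ℕ → ℤ⟦X⟧ := fun m p => X ^ ((m + 1) * p) * invPoch p with hf
  have hs (m : ℕ) : Summable (f m) :=
    summable_of_X_pow_dvd id (fun p => ⟨X ^ (m * p) * invPoch p, by simp only [hf, id]; ring⟩)
      Set.finite_Iic
  have hf0 (m : ℕ) : f m 0 = 1 := by simp [hf, invPoch_zero]
  have hrec (m : ℕ) : ∑' p, f (m + 1) p = (1 - X ^ (m + 1)) * ∑' p, f m p := by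
    have h : ∑' p, f m p - ∑' p, f (m + 1) p = X ^ (m + 1) * ∑' p, f m p := by
      rw [← (hs m).tsum_sub (hs (m + 1)), ← (hs m).tsum_mul_left,
        ((hs m).sub (hs (m + 1))).tsum_eq_zero_add, hf0, hf0, sub_self, zero_add]
      refine tsum_congr fun p => ?_
      simp only [hf]
      rw [← one_sub_mul_invPoch_succ p]
      ring
    linear_combination -h
  -- As `M` grows the right side tends to `1`, so `∑' p, f N p` is the reciprocal of
  -- `(q^{N+1};q)_∞`.
  have hit (M : ℕ) : poch (X ^ (N + 1)) M * ∑' p, f N p = ∑' p, f (N + M) p := by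
    induction M with
    | zero => simp [poch_zero]
    | succ M ih => rw [← add_assoc, hrec (N + M), poch_succ, ← ih]; ring
  have hlim : Tendsto (fun M => ∑' p, f (N + M) p) atTop (𝓝 1) := by
    refine tendsto_of_X_pow_dvd_sub fun M => ?_
    rw [(hs _).tsum_eq_zero_add, hf0, add_sub_cancel_left]
    refine X_pow_dvd_of_hasSum ((summable_nat_add_iff 1).2 (hs (N + M))).hasSum fun p =>
      ⟨X ^ (N + 1 + (N + M + 1) * p) * invPoch (p + 1), ?_⟩
    simp only [hf]
    ring
  have h := tendsto_nhds_unique (((tendsto_poch (X ^ (N + 1))).mul_const _).congr hit) hlim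
  have h1 := pochInf_eq_poch_mul 1 N
  rw [pow_one, add_comm 1 N] at h1
  have h2 := (hs N).hasSum.mul_left (pochInf X)
  rwa [h1, mul_assoc, h, mul_one, ← h1] at h2

theorem hasSum_antidiagonal {f : ℕ × ℕ → ℤ⟦X⟧} {s : ℤ⟦X⟧} (h : HasSum f s) :
    HasSum (fun n => ∑ x ∈ antidiagonal n, f x) s := by
  refine ((HasAntidiagonal.sigmaAntidiagonalEquivProd (A := ℕ)).hasSum_iff.2 h).sigma fun n => ?_
  rw [← sum_coe_sort]
  exact hasSum_fintype _

end QSeries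

/-! ### The fourfold series and the product of partial theta functions -/

namespace QSeries

open PowerSeries Finset Filter

open scoped PowerSeries.WithPiTopology Topology

/-- The summand of the fourfold series obtained by expanding every factor of `termC`. -/
noncomputable def expandedTerm (x : (ℕ × ℕ) × (ℕ × ℕ)) : ℤ⟦X⟧ :=
  pochInf X * invPoch x.1.1 * invPoch x.1.2 *
    ((-1) ^ x.1.1 * X ^ (x.1.1 + x.1.2 + (x.1.1 + x.1.2) * x.1.1 + x.1.1.choose 2)) *
    (((-1) ^ x.2.1 * X ^ ((x.1.1 + x.1.2) * x.2.1 + x.2.1.choose 2) * invPoch x.2.1) *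
      ((-1) ^ x.2.2 * X ^ ((x.1.1 + x.1.2 + 1) * x.2.2 + x.2.2.choose 2) * invPoch x.2.2))

/-- The linear exponent of the first Euler index vanishes when `r = p = 0`, so the order bound
relies on the quadratic `choose 2` terms instead. -/
theorem summable_expandedTerm : Summable expandedTerm := by
  refine summable_of_X_pow_dvd
    (fun x => x.1.1 + x.1.2 + (x.2.1.choose 2 + x.2.2.choose 2)) (fun x => ?_) fun N => ?_
  · refine ⟨pochInf X * invPoch x.1.1 * invPoch x.1.2 *
      ((-1) ^ x.1.1 * X ^ ((x.1.1 + x.1.2) * x.1.1 + x.1.1.choose 2)) *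
      (((-1) ^ x.2.1 * X ^ ((x.1.1 + x.1.2) * x.2.1) * invPoch x.2.1) *
      ((-1) ^ x.2.2 * X ^ ((x.1.1 + x.1.2 + 1) * x.2.2) * invPoch x.2.2)), ?_⟩
    simp only [expandedTerm]
    ring
  · refine ((((Set.finite_Iic N).prod (Set.finite_Iic N)).prod
      ((finite_choose_two_le N).prod (finite_choose_two_le N)))).subset fun x hx => ?_
    simp only [Set.mem_ofPred_eq, Set.mem_prod, Set.mem_Iic] at hx ⊢
    omega

theorem hasSum_termC : HasSum termC (∑' x, expandedTerm x) := by
  have h := hasSum_antidiagonal (summable_expandedTerm.hasSum.prod_fiberwise fun x => by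
    have h := ((hasSum_pochInf (x.1 + x.2)).mul (hasSum_pochInf (x.1 + x.2 + 1))
      (summable_of_X_pow_dvd (fun y => y.1.choose 2 + y.2.choose 2)
        (fun y => ⟨(-1) ^ y.1 * X ^ ((x.1 + x.2) * y.1) * invPoch y.1 *
          ((-1) ^ y.2 * X ^ ((x.1 + x.2 + 1) * y.2) * invPoch y.2), by ring⟩)
        fun N => ((finite_choose_two_le N).prod (finite_choose_two_le N)).subset fun y hy => ?_))
    · exact h.mul_left (pochInf X * invPoch x.1 * invPoch x.2 *
        ((-1) ^ x.1 * X ^ (x.1 + x.2 + (x.1 + x.2) * x.1 + x.1.choose 2)))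
    · simp only [Set.mem_ofPred_eq, Set.mem_prod] at hy ⊢
      omega)
  convert h using 1
  funext n
  -- One factor `(q^{n+1};q)_∞` merges with the numerator `(q;q)_n` of the Gaussian binomial into
  -- `(q;q)_∞`, which no longer depends on `n`.
  have h1 := pochInf_eq_poch_mul 1 n
  rw [pow_one, add_comm 1 n] at h1
  rw [termC, poch_eq_sum_gauss, mul_sum]
  refine sum_congr rfl fun x hx => ?_
  rw [mem_antidiagonal.1 hx, h1, gauss, mem_antidiagonal.1 hx]
  ring

/-- The coefficients of the partial theta function `∑ (-1)^i a^i q^{i(i-1)/2}` at `a = 1`. -/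
noncomputable def thetaTerm (i : ℕ) : ℤ⟦X⟧ := (-1) ^ i * X ^ i.choose 2

theorem summable_thetaTerm : Summable thetaTerm :=
  summable_of_X_pow_dvd (fun i => i.choose 2) (fun i => ⟨(-1) ^ i, by rw [thetaTerm, mul_comm]⟩)
    finite_choose_two_le

theorem summable_thetaTerm_mul_X_pow : Summable fun i => thetaTerm i * X ^ i :=
  summable_of_X_pow_dvd id (fun _ => Dvd.intro_left _ rfl) Set.finite_Iic

/-- The summand that remains of `expandedTerm` after summing over its second index. -/
noncomputable def collectedTerm (y : ℕ × ℕ × ℕ) : ℤ⟦X⟧ :=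
  thetaTerm y.1 * (thetaTerm (y.2.1 + y.2.2) * X ^ (y.2.1 + y.2.2) *
    (vanderCoeff y.1 y.2.1 * gauss y.1 y.2.2))

theorem hasSum_collectedTerm : HasSum collectedTerm (∑' x, expandedTerm x) := by
  let φ : (ℕ × ℕ × ℕ) × ℕ ≃ (ℕ × ℕ) × (ℕ × ℕ) :=
    ⟨fun y => ((y.1.1, y.2), y.1.2), fun x => ((x.1.1, x.2), x.1.2), fun _ => rfl, fun _ => rfl⟩
  have h := (φ.hasSum_iff.2 summable_expandedTerm.hasSum).prod_fiberwise fun y =>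
    ((hasSum_poch (y.1 + y.2.1 + y.2.2)).mul_left
      (invPoch y.1 * invPoch y.2.1 * invPoch y.2.2 * (-1) ^ (y.1 + y.2.1 + y.2.2) *
        X ^ (y.1 + y.1 * y.1 + y.1.choose 2 + y.1 * y.2.1 + y.2.1.choose 2 +
          (y.1 + 1) * y.2.2 + y.2.2.choose 2))).congr_fun fun p => by
      simp only [φ, Function.comp, Equiv.coe_fn_mk, expandedTerm]
      ring
  -- The substitution `i = r + k`. Its image is `r ≤ i`; elsewhere `vanderCoeff i r` vanishes.
  let ψ : ℕ × ℕ × ℕ → ℕ × ℕ × ℕ := fun y => (y.1 + y.2.1, y.1, y.2.2)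
  have hψ : Function.Injective ψ := by
    rintro ⟨r, k, l⟩ ⟨r', k', l'⟩ h
    simp only [ψ, Prod.mk.injEq] at h ⊢
    omega
  refine (hψ.hasSum_iff fun y hy => ?_).1 ?_
  · have : y.1 < y.2.1 := by
      by_contra hlt
      exact hy ⟨(y.2.1, y.1 - y.2.1, y.2.2), by ext <;> simp [ψ]; omega⟩
    rw [collectedTerm, vanderCoeff_eq_zero this]
    ring
  · convert h using 1
    funext y
    simp only [Function.comp, ψ, collectedTerm, thetaTerm, vanderCoeff_add, gauss]
    rw [choose_two_succ, choose_two_add, choose_two_add, sq_eq_choose_two]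
    -- The two theta signs and that of `vanderCoeff` exceed the expanded sign by `(-1)^{2r}`, and
    -- `(q;q)_{r+k}` cancels between the two Gaussian binomials.
    have hsign : ((-1) ^ y.1 : ℤ⟦X⟧) * (-1) ^ y.1 * (poch X (y.1 + y.2.1) *
        invPoch (y.1 + y.2.1)) = 1 := by
      rw [poch_mul_invPoch, mul_one, ← mul_pow, neg_one_mul, neg_neg, one_pow]
    linear_combination (invPoch y.1 * invPoch y.2.1 * invPoch y.2.2 *
      (-1) ^ (y.1 + y.2.1 + y.2.2) * poch X (y.1 + y.2.1 + y.2.2) *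
      X ^ (y.1 + (2 * y.1.choose 2 + y.1) + y.1.choose 2 + y.1 * y.2.1 + y.2.1.choose 2 +
          (y.1 + 1) * y.2.2 + y.2.2.choose 2)) * hsign

/-- A case of the Andrews–Warnaar product formula for partial theta functions. -/
theorem seriesC_eq : seriesC = (∑' i, thetaTerm i) * ∑' j, thetaTerm j * X ^ j := by
  -- `(1;q)_∞` contains the factor `1 - 1`, so the sum may start at `0`.
  have h0 : termC 0 = 0 := by
    have h := pochInf_eq_poch_mul 0 1
    rw [poch_succ, poch_zero] at h
    rw [termC, h]
    simp
  have h1 := (hasSum_nat_add_iff' 1).2 hasSum_termC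
  rw [sum_range_one, h0, sub_zero] at h1
  have h2 := hasSum_collectedTerm.prod_fiberwise fun i =>
    (hasSum_collectedTerm.summable.prod_factor i).hasSum
  -- Grouping by `j = r + l` leaves exactly the Vandermonde sum.
  have h3 (i : ℕ) : ∑' y, collectedTerm (i, y) = thetaTerm i * ∑' j, thetaTerm j * X ^ j := by
    refine (hasSum_antidiagonal (hasSum_collectedTerm.summable.prod_factor i).hasSum).unique
      ((summable_thetaTerm_mul_X_pow.hasSum.mul_left (thetaTerm i)).congr_fun fun j => ?_)
    rw [← mul_one (thetaTerm j * X ^ j), ← sum_vanderCoeff_mul_gauss i j, mul_sum, mul_sum]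
    refine sum_congr rfl fun x hx => ?_
    rw [collectedTerm, mem_antidiagonal.1 hx]
  simp only [h3] at h2
  exact h1.tsum_eq.trans (h2.unique (summable_thetaTerm.hasSum.mul_right _))

end QSeries

/-! ### Vanishing of coefficients -/

namespace QSeries

open PowerSeries Finset

open scoped PowerSeries.WithPiTopology

theorem coeff_tsum_eq_zero {ι : Type*} {f : ι → ℤ⟦X⟧} (hf : Summable f) {d : ℕ}
    (h : ∀ i, coeff d (f i) = 0) : coeff d (∑' i, f i) = 0 := by
  have h' := (WithPiTopology.hasSum_iff_hasSum_coeff ℤ).1 hf.hasSum d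
  simp only [h] at h'
  exact h'.unique hasSum_zero

theorem exists_triangular_eq_choose_two (i : ℕ) : ∃ a : ℕ, i.choose 2 = a * (a + 1) / 2 := by
  cases i with
  | zero => exact ⟨0, rfl⟩
  | succ i => exact ⟨i, by rw [Nat.choose_two_right, Nat.add_sub_cancel, mul_comm]⟩

theorem coeff_thetaTerm {i d : ℕ} (h : d ≠ i.choose 2) : coeff d (thetaTerm i) = 0 := by
  rw [thetaTerm]
  rcases neg_one_pow_eq_or ℤ⟦X⟧ i with h' | h' <;> simp [h', coeff_X_pow, h]

/-- The coefficients of `seriesC` vanish off the sums of two triangular numbers. -/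
theorem coeff_seriesC_eq_zero {n : ℕ} (hn : ¬ IsSumOfTwoTriangular n) :
    coeff n seriesC = 0 := by
  rw [seriesC_eq, coeff_mul]
  refine sum_eq_zero fun x hx => ?_
  by_contra hne
  obtain ⟨h1, h2⟩ := not_or.1 (mt mul_eq_zero.2 hne)
  obtain ⟨i, hi⟩ : ∃ i : ℕ, x.1 = i.choose 2 := by
    by_contra! h
    exact h1 (coeff_tsum_eq_zero summable_thetaTerm fun i => coeff_thetaTerm (h i))
  obtain ⟨j, hj⟩ : ∃ j : ℕ, x.2 = (j + 1).choose 2 := by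
    by_contra! h
    refine h2 (coeff_tsum_eq_zero summable_thetaTerm_mul_X_pow fun j => ?_)
    rw [coeff_mul_X_pow']
    split_ifs with hj
    · refine coeff_thetaTerm fun h' => h j ?_
      rw [choose_two_succ]
      omega
    · rfl
  obtain ⟨a, ha⟩ := exists_triangular_eq_choose_two i
  obtain ⟨b, hb⟩ := exists_triangular_eq_choose_two (j + 1)
  exact hn ⟨a, b, by rw [← ha, ← hb, ← hi, ← hj, mem_antidiagonal.1 hx]⟩

/-! ### Coefficients of `termC` as signed counts of sets of parts -/

theorem poch_X_pow_eq_prod_Ico (m M : ℕ) :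
    poch (X ^ m) M = ∏ k ∈ Ico m (m + M), (1 - X ^ k) := by
  rw [prod_Ico_eq_prod_range, Nat.add_sub_cancel_left, poch]
  simp only [pow_add]

theorem X_pow_dvd_pochInf_sub_prod {m N : ℕ} (h : m ≤ N) :
    X ^ N ∣ pochInf (X ^ m) - ∏ k ∈ Ico m N, (1 - X ^ k) := by
  obtain ⟨M, rfl⟩ := Nat.exists_eq_add_of_le h
  rw [pochInf_eq_poch_mul m M, poch_X_pow_eq_prod_Ico]
  exact (Dvd.dvd.mul_left (X_pow_dvd_pochInf_sub_one (m + M))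
    (∏ k ∈ Ico m (m + M), (1 - X ^ k))).trans (dvd_of_eq (by ring))

theorem prod_one_sub_X_pow_eq_sum (I : Finset ℕ) :
    ∏ k ∈ I, (1 - X ^ k : ℤ⟦X⟧) = ∑ A ∈ I.powerset, (-1) ^ #A * X ^ A.sum id := by
  simp only [sub_eq_add_neg, prod_one_add, prod_neg]
  exact sum_congr rfl fun A _ => by rw [prod_pow_eq_pow_sum]; rfl

theorem sum_mul_sum_eq_sum_product {ι κ R : Type*} [NonUnitalNonAssocSemiring R]
    (s : Finset ι) (t : Finset κ) (f : ι → R) (g : κ → R) :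
    (∑ i ∈ s, f i) * ∑ j ∈ t, g j = ∑ x ∈ s ×ˢ t, f x.1 * g x.2 := by
  rw [sum_mul_sum, sum_product]

/-- The quadruples of sets of parts that remain of a counted pair with smallest part `s`
once the overlined `s` has been removed. -/
def partSets (n s : ℕ) : Finset (Finset ℕ × Finset ℕ × Finset ℕ × Finset ℕ) :=
  (Ico (s + 1) (n + 1)).powerset ×ˢ (Ico s (n + 1)).powerset ×ˢ
    (Ico (s + 1) (n + 1)).powerset ×ˢ (Ico s (s + s)).powerset

/-- Modulo `X ^ (n + 1)` the infinite products may be cut off after the part `n`; expanding a finite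
product chooses a set of parts with its sign. -/
theorem coeff_termC {n s : ℕ} (h : s ≤ n) :
    coeff n (termC s) = ∑ x ∈ partSets n s with
      s + (x.1.sum id + (x.2.1.sum id + (x.2.2.1.sum id + x.2.2.2.sum id))) = n,
      (-1 : ℤ) ^ (#x.1 + (#x.2.1 + (#x.2.2.1 + #x.2.2.2))) := by
  have hdvd : X ^ (n + 1) ∣ termC s - X ^ s * ((∏ k ∈ Ico (s + 1) (n + 1), (1 - X ^ k)) *
      ((∏ k ∈ Ico s (n + 1), (1 - X ^ k)) * ((∏ k ∈ Ico (s + 1) (n + 1), (1 - X ^ k)) *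
        ∏ k ∈ Ico s (s + s), (1 - X ^ k)))) := by
    have h1 := X_pow_dvd_pochInf_sub_prod (m := s + 1) (N := n + 1) (by omega)
    have h2 := X_pow_dvd_pochInf_sub_prod (m := s) (N := n + 1) (by omega)
    have h3 := dvd_mul_sub_mul h1 (dvd_mul_sub_mul h2 h1)
    rw [termC, poch_X_pow_eq_prod_Ico s s]
    exact (Dvd.dvd.mul_left h3 (X ^ s * ∏ k ∈ Ico s (s + s), (1 - X ^ k))).trans
      (dvd_of_eq (by ring))
  have hc := X_pow_dvd_iff.1 hdvd n (Nat.lt_succ_self n)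
  rw [map_sub, sub_eq_zero] at hc
  rw [hc]
  rw [prod_one_sub_X_pow_eq_sum, prod_one_sub_X_pow_eq_sum, prod_one_sub_X_pow_eq_sum,
    sum_mul_sum_eq_sum_product, sum_mul_sum_eq_sum_product, sum_mul_sum_eq_sum_product,
    mul_sum, map_sum, sum_filter]
  refine sum_congr rfl fun ⟨A, B, C, D⟩ _ => ?_
  have e : X ^ s * ((-1) ^ #A * X ^ A.sum id * ((-1) ^ #B * X ^ B.sum id *
      ((-1) ^ #C * X ^ C.sum id * ((-1) ^ #D * X ^ D.sum id)))) =
      PowerSeries.C ((-1 : ℤ) ^ (#A + (#B + (#C + #D)))) *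
        X ^ (s + (A.sum id + (B.sum id + (C.sum id + D.sum id)))) := by
    simp only [map_pow, map_neg, map_one]
    ring
  rw [e, coeff_C_mul, coeff_X_pow]
  simp [eq_comm]

theorem coeff_seriesC (n : ℕ) : coeff n seriesC = ∑ s ∈ Icc 1 n, coeff n (termC s) := by
  have h := (WithPiTopology.hasSum_iff_hasSum_coeff ℤ).1 summable_termC.hasSum n
  have h0 : ∀ m ∉ range n, coeff n (termC (m + 1)) = 0 := fun m hm => by
    rw [mem_range, not_lt] at hm
    refine X_pow_dvd_iff.1 (?_ : X ^ (m + 1) ∣ _) n (by omega)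
    rw [termC, mul_assoc, mul_assoc]
    exact Dvd.intro _ rfl
  rw [seriesC, h.unique (hasSum_sum_of_ne_finset_zero h0), range_eq_Ico,
    sum_Ico_add' (fun s => coeff n (termC s)) 0 n 1]
  rfl

end QSeries

/-! ### Triangular numbers and squares -/

theorem isSumOfTwoTriangular_iff (n : ℕ) :
    IsSumOfTwoTriangular n ↔ IsSumOfTwoSquares (8 * n + 2) := by
  have h2 (a : ℕ) : 2 * (a * (a + 1) / 2) = a * (a + 1) :=
    Nat.mul_div_cancel' (Nat.even_mul_succ_self a).two_dvd
  constructor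
  · rintro ⟨a, b, rfl⟩
    refine ⟨2 * a + 1, 2 * b + 1, ?_⟩
    have ha := h2 a
    have hb := h2 b
    zify at ha hb
    push_cast
    linear_combination 4 * ha + 4 * hb
  · rintro ⟨x, y, h⟩
    -- Squares are `0` or `1` modulo `4`, and the sum is `2` modulo `4`.
    have hx : x % 2 = 1 ∧ y % 2 = 1 := by
      have hx4 : x ^ 2 % 4 = 0 ∧ x % 2 = 0 ∨ x ^ 2 % 4 = 1 ∧ x % 2 = 1 := by
        rcases Int.emod_two_eq_zero_or_one x with h | h
        · exact .inl ⟨by obtain ⟨k, rfl⟩ := Int.dvd_of_emod_eq_zero h; ring_nf; omega, h⟩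
        · exact .inr ⟨Int.sq_mod_four_eq_one_of_odd (Int.odd_iff.2 h), h⟩
      have hy4 : y ^ 2 % 4 = 0 ∧ y % 2 = 0 ∨ y ^ 2 % 4 = 1 ∧ y % 2 = 1 := by
        rcases Int.emod_two_eq_zero_or_one y with h | h
        · exact .inl ⟨by obtain ⟨k, rfl⟩ := Int.dvd_of_emod_eq_zero h; ring_nf; omega, h⟩
        · exact .inr ⟨Int.sq_mod_four_eq_one_of_odd (Int.odd_iff.2 h), h⟩
      push_cast at h
      omega
    have key (z : ℤ) (hz : z % 2 = 1) : ∃ a : ℕ, z ^ 2 = (2 * a + 1) ^ 2 := by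
      refine ⟨z.natAbs / 2, ?_⟩
      have : (2 * ((z.natAbs / 2 : ℕ) : ℤ) + 1) = |z| := by rw [Int.abs_eq_natAbs]; omega
      rw [this, sq_abs]
    obtain ⟨a, ha⟩ := key x hx.1
    obtain ⟨b, hb⟩ := key y hx.2
    refine ⟨a, b, ?_⟩
    have ha' := h2 a
    have hb' := h2 b
    zify at ha' hb'
    rw [ha, hb] at h
    push_cast at h
    zify
    linarith

/-! ### Overpartition pairs and the generating function of `C'` -/

namespace OverpartitionPair

open Finset

/-- The smallest overlined part of the first component. -/
noncomputable def leastOverlined (p : OverpartitionPair) : ℕ := sInf (p.1.overlined : Set ℕ)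

theorem parts_eq (p : OverpartitionPair) :
    p.parts = (p.1.overlined.val + p.1.nonOverlined) + (p.2.overlined.val + p.2.nonOverlined) :=
  rfl

/-- The witness `s` is overlined in the first component and least among all parts, so it is
recovered as the least overlined part there. -/
theorem CountedByC.leastOverlined_spec {n : ℕ} {p : OverpartitionPair} (h : CountedByC n p) :
    leastOverlined p ∈ p.1.overlined ∧ (∀ k ∈ p.parts, leastOverlined p ≤ k) ∧
      (∀ k ∈ p.2.overlined, leastOverlined p < k) ∧
      (∀ k ∈ p.2.nonOverlined, k < 2 * leastOverlined p) := by
  obtain ⟨-, -, -, s, h1, -, h3, h4, h5⟩ := h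
  have e : leastOverlined p = s := by
    refine IsLeast.csInf_eq ⟨h3, fun k hk => h1.2 ?_⟩
    simp only [Set.mem_ofPred_eq, parts_eq, Multiset.mem_add, mem_val]
    exact .inl (.inl hk)
  rw [e]
  exact ⟨h3, fun k hk => h1.2 hk, h4, h5⟩

theorem C'_eq_sum (n : ℕ) :
    C' n = ∑ p ∈ (finite_countedByC n).toFinset, (-1 : ℤ) ^ (p.numParts + 1) := by
  classical
  have h1 : C₁ n = #{p ∈ (finite_countedByC n).toFinset | Odd p.numParts} := by
    rw [C₁, ← Set.ncard_coe_finset]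
    congr 1
    ext p
    simp
  have h0 : C₀ n = #{p ∈ (finite_countedByC n).toFinset | Even p.numParts} := by
    rw [C₀, ← Set.ncard_coe_finset]
    congr 1
    ext p
    simp
  rw [C', h1, h0, card_filter, card_filter]
  push_cast
  rw [← sum_sub_distrib]
  refine sum_congr rfl fun p _ => ?_
  rcases Nat.even_or_odd p.numParts with h | h
  · rw [if_neg (Nat.not_odd_iff_even.2 h), if_pos h, pow_succ, h.neg_one_pow]
    rfl
  · rw [if_pos h, if_neg (Nat.not_even_iff_odd.2 h), pow_succ, h.neg_one_pow]
    rfl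

/-- The four sets of parts of a pair, without its smallest overlined part. -/
noncomputable def toPartSets (p : OverpartitionPair) :
    Finset ℕ × Finset ℕ × Finset ℕ × Finset ℕ :=
  (p.1.overlined.erase (leastOverlined p), p.1.nonOverlined.toFinset, p.2.overlined,
    p.2.nonOverlined.toFinset)

theorem CountedByC.sum_toPartSets {n : ℕ} {p : OverpartitionPair} (h : CountedByC n p) :
    leastOverlined p + ((toPartSets p).1.sum id + ((toPartSets p).2.1.sum id +
      ((toPartSets p).2.2.1.sum id + (toPartSets p).2.2.2.sum id))) = n := by
  have e (s : Multiset ℕ) (hs : s.Nodup) : s.toFinset.sum id = s.sum := by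
    rw [Finset.sum, Multiset.toFinset_val, hs.dedup, Multiset.map_id]
  have e' (s : Finset ℕ) : s.sum id = s.val.sum := by rw [Finset.sum, Multiset.map_id]
  have h' := h.1
  rw [IsPairOf, parts_eq] at h'
  simp only [Multiset.sum_add, ← e'] at h'
  have ho : leastOverlined p + (p.1.overlined.erase (leastOverlined p)).sum id =
    p.1.overlined.sum id := add_sum_erase _ id h.leastOverlined_spec.1
  rw [← ho] at h'
  simp only [toPartSets]
  rw [e _ h.2.1, e _ h.2.2.1]
  omega

theorem CountedByC.numParts_eq {n : ℕ} {p : OverpartitionPair} (h : CountedByC n p) :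
    p.numParts = #(toPartSets p).1 + (#(toPartSets p).2.1 +
      (#(toPartSets p).2.2.1 + #(toPartSets p).2.2.2)) + 1 := by
  have e := card_erase_add_one h.leastOverlined_spec.1
  simp only [toPartSets, numParts, parts_eq, Multiset.card_add, card_val]
  rw [Multiset.toFinset_card_of_nodup h.2.1, Multiset.toFinset_card_of_nodup h.2.2.1]
  omega

theorem CountedByC.toPartSets_mem {n : ℕ} {p : OverpartitionPair} (h : CountedByC n p) :
    toPartSets p ∈ QSeries.partSets n (leastOverlined p) := by
  obtain ⟨-, h2, h3, h4⟩ := h.leastOverlined_spec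
  have hle : ∀ k ∈ p.parts, k ≤ n := fun k hk => h.1 ▸ Multiset.le_sum_of_mem hk
  simp only [parts_eq, Multiset.mem_add, mem_val] at h2 hle
  simp only [QSeries.partSets, toPartSets, mem_product, mem_powerset, subset_iff, mem_Ico,
    mem_erase, Multiset.mem_toFinset]
  refine ⟨fun k hk => ?_, fun k hk => ?_, fun k hk => ?_, fun k hk => ?_⟩
  · have := h2 k (by tauto)
    have := hle k (by tauto)
    have := hk.1
    omega
  · have := h2 k (by tauto)
    have := hle k (by tauto)
    omega
  · have := h3 k hk
    have := hle k (by tauto)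
    omega
  · have := h4 k hk
    have := h2 k (by tauto)
    omega

theorem exists_countedByC {n s : ℕ} (hs : 0 < s)
    {x : Finset ℕ × Finset ℕ × Finset ℕ × Finset ℕ} (hx : x ∈ QSeries.partSets n s)
    (hn : s + (x.1.sum id + (x.2.1.sum id + (x.2.2.1.sum id + x.2.2.2.sum id))) = n) :
    ∃ p, CountedByC n p ∧ leastOverlined p = s ∧ toPartSets p = x := by
  obtain ⟨A, B, C, D⟩ := x
  simp only [QSeries.partSets, mem_product, mem_powerset, subset_iff, mem_Ico] at hx hn
  obtain ⟨hA, hB, hC, hD⟩ := hx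
  have hsA : s ∉ A := fun h => by have := hA h; omega
  let p : OverpartitionPair :=
    (⟨insert s A, B.val, fun k hk => by
        rcases mem_insert.1 hk with rfl | hk
        · exact hs
        · have := hA hk; omega,
      fun k hk => by have := hB hk; omega⟩,
     ⟨C, D.val, fun k hk => by have := hC hk; omega, fun k hk => by have := hD hk; omega⟩)
  have hmin : ∀ k ∈ p.parts, s ≤ k := fun k hk => by
    simp only [p, parts_eq, Multiset.mem_add, mem_val, mem_insert] at hk
    rcases hk with ((rfl | hk) | hk) | hk | hk
    · exact le_rfl
    · have := hA hk; omega
    · exact (hB hk).1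
    · have := hC hk; omega
    · exact (hD hk).1
  have hmem : s ∈ p.1.parts := by simp [p, Overpartition.parts]
  have hp : CountedByC n p := by
    refine ⟨?_, B.nodup, D.nodup, s, ⟨Multiset.mem_add.2 (.inl hmem), hmin⟩,
      ⟨hmem, fun k hk => hmin k (Multiset.mem_add.2 (.inl hk))⟩, mem_insert_self s A,
      fun k hk => by have := hC hk; omega, fun k hk => by have := hD hk; omega⟩
    have e' (s : Finset ℕ) : s.val.sum = s.sum id := by rw [Finset.sum, Multiset.map_id]
    rw [IsPairOf, parts_eq]
    simp only [p, Multiset.sum_add, e', sum_insert hsA, id]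
    simp only [id] at hn
    omega
  have hleast : leastOverlined p = s := by
    have h := hp.leastOverlined_spec
    refine le_antisymm (h.2.1 s (Multiset.mem_add.2 (.inl hmem))) (hmin _ ?_)
    simp only [parts_eq, Multiset.mem_add, mem_val]
    exact .inl (.inl h.1)
  refine ⟨p, hp, hleast, ?_⟩
  rw [toPartSets, hleast]
  simp [p, erase_insert hsA]

theorem eq_of_toPartSets_eq {n : ℕ} {p p' : OverpartitionPair} (h : CountedByC n p)
    (h' : CountedByC n p') (hl : leastOverlined p = leastOverlined p')
    (he : toPartSets p = toPartSets p') : p = p' := by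
  simp only [toPartSets, Prod.mk.injEq] at he
  obtain ⟨h1, h2, h3, h4⟩ := he
  refine Prod.ext (Overpartition.ext ?_ ?_) (Overpartition.ext h3 ?_)
  · rw [← insert_erase h.leastOverlined_spec.1, h1, hl, insert_erase h'.leastOverlined_spec.1]
  · rw [← Multiset.dedup_eq_self.2 h.2.1, ← Multiset.dedup_eq_self.2 h'.2.1]
    exact congrArg Finset.val h2
  · rw [← Multiset.dedup_eq_self.2 h.2.2.1, ← Multiset.dedup_eq_self.2 h'.2.2.1]
    exact congrArg Finset.val h4

/-- The generating function of `C'`. -/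
theorem C'_eq_coeff_seriesC (n : ℕ) : C' n = PowerSeries.coeff n QSeries.seriesC := by
  classical
  rw [C'_eq_sum, QSeries.coeff_seriesC, ← sum_fiberwise_of_maps_to (g := leastOverlined)
    (t := Icc 1 n)]
  · refine sum_congr rfl fun s hs => ?_
    rw [mem_Icc] at hs
    rw [QSeries.coeff_termC hs.2]
    refine sum_bij (fun p _ => toPartSets p) ?_ ?_ ?_ ?_
    · intro p hp
      simp only [mem_filter, Set.Finite.mem_toFinset, Set.mem_ofPred_eq] at hp ⊢
      obtain ⟨hp, rfl⟩ := hp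
      exact ⟨hp.toPartSets_mem, hp.sum_toPartSets⟩
    · intro p hp p' hp' he
      simp only [mem_filter, Set.Finite.mem_toFinset, Set.mem_ofPred_eq] at hp hp'
      exact eq_of_toPartSets_eq hp.1 hp'.1 (hp.2.trans hp'.2.symm) he
    · intro x hx
      rw [mem_filter] at hx
      obtain ⟨p, hp, hl, he⟩ := exists_countedByC hs.1 hx.1 hx.2
      exact ⟨p, by simpa using ⟨hp, hl⟩, he⟩
    · intro p hp
      simp only [mem_filter, Set.Finite.mem_toFinset, Set.mem_ofPred_eq] at hp
      -- The erased overlined `s` and the shift in the exponent of the sign together contribute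
      -- `(-1)^2`.
      rw [hp.1.numParts_eq, add_assoc _ 1 1, pow_add]
      norm_num
  · intro p hp
    rw [Set.Finite.mem_toFinset, Set.mem_ofPred_eq] at hp
    rw [mem_Icc]
    exact ⟨p.1.overlined_pos _ hp.leastOverlined_spec.1, hp.sum_toPartSets ▸ Nat.le_add_right _ _⟩

end OverpartitionPair

theorem mainTheorem9 :
    (∀ n : ℕ, IsSumOfTwoTriangular n ↔ IsSumOfTwoSquares (8 * n + 2)) ∧
    ∀ n : ℕ, 0 < n → ¬ IsSumOfTwoTriangular n →
      OverpartitionPair.C' n = 0 ∧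
      OverpartitionPair.C₀ n = OverpartitionPair.C₁ n ∧
      PowerSeries.coeff n QSeries.seriesC = 0 := by
  refine ⟨isSumOfTwoTriangular_iff, fun n _ hn => ?_⟩
  have h := QSeries.coeff_seriesC_eq_zero hn
  have hC : OverpartitionPair.C' n = 0 := (OverpartitionPair.C'_eq_coeff_seriesC n).trans h
  refine ⟨hC, ?_, h⟩
  rw [OverpartitionPair.C', sub_eq_zero] at hC
  exact_mod_cast hC.symm
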